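/- Let $\mathscr Q_n$ be a non-singular quadric in $\mathrm{PG}(n,2)$ of projective index $g\ge 1$ (the largest projective dimension of a subspace contained in $\mathscr Q_n$). Let $\Gamma$ be its point-graph: the vertices are the points of $\mathscr Q_n$, and two distinct points are adjacent if and only if they lie on a line contained in $\mathscr Q_n$. Let $0\le s<g$ and let $\alpha_s$ be an $s$-dimensional subspace contained in $\mathscr Q_n$. A point of $\mathscr Q_n$ is of type (i) if it lies in $\alpha_s$; of type (ii) if it is not in $\alpha_s$ but lies in some $(s+1)$-dimensional subspace $\Pi$ with $\alpha_s\subset\Pi\subset\mathscr Q_n$; and of type (iii) otherwise. Let $\mathcal X_s$ be the set of points of type (ii). Let $\Gamma_s$ be the graph obtained from $\Gamma$ by the Godsil–McKay construction with the partition of the vertices into $\mathcal X_s$ and its complement: for each vertex $R\notin\mathcal X_s$ with exactly $\frac12|\mathcal X_s|$ neighbours in $\mathcal X_s$, delete the edges from $R$ to $\mathcal X_s$ and join $R$ to the other $\frac12|\mathcal X_s|$ vertices of $\mathcal X_s$; all other edges are kept. Then $\Gamma_s$ is isomorphic to $\Gamma$ if and only if $s=0$. Moreover: 1. If $s=0$,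 then an isomorphism from $\Gamma$ to $\Gamma_0$ is given by the involution on the points of $\mathscr Q_n$ that fixes all points of types (i) and (iii) and that sends each point $X$ of type (ii) to the other point of type (ii) on the line joining $X$ to the point $\alpha_0$. 2. If $s\ge 1$, then the number of maximal cliques of $\Gamma_s$ differs from the number of maximal cliques of $\Gamma$. This holds both when "maximal" means of maximum size and when it means maximal with respect to inclusion. -/

import Mathlib

open scoped LinearAlgebra.Projectivization

noncomputable section

namespace Quadric

variable {K V : Type*} [Field K] [AddCommGroup V] [Module K V]

/-- A quadratic form defines a non-singular quadric: no nonzero singular vector is orthogonal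
(for the polar form) to the whole space.  Equivalently, no linear change of coordinates turns `Q`
into a form in fewer variables.  In characteristic two and odd dimension this allows the polar form
itself to be degenerate (parabolic quadrics). -/
def IsNonsingular (Q : QuadraticForm K V) : Prop :=
  Q.radical = ⊥

/-- The subspace `W` of the projective space is a `d`-space, that is, it has projective
dimension `d`. -/
def IsSpace (d : ℕ) (W : Submodule K V) : Prop :=
  Module.finrank K W = d + 1

/-- The subspace `W` is contained in the quadric `Q = 0`. -/
def ContainedIn (Q : QuadraticForm K V) (W : Submodule K V) : Prop :=
  ∀ v ∈ W, Q v = 0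

/-- The points of the quadric `Q = 0`. -/
abbrev Point (Q : QuadraticForm K V) : Type _ :=
  {X : ℙ K V // ContainedIn Q X.submodule}

/-- The one-dimensional linear subspace that is the point `X`. -/
abbrev Point.space {Q : QuadraticForm K V} (X : Point Q) : Submodule K V :=
  X.1.submodule

/-- `g` is the projective index of the quadric: the largest projective dimension of a subspace
contained in it.  (Quadrics without points, whose index is `-1`, have no index in this sense.) -/
def HasProjectiveIndex (Q : QuadraticForm K V) (g : ℕ) : Prop :=
  IsGreatest {d : ℕ | ∃ W : Submodule K V, IsSpace d W ∧ ContainedIn Q W} g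

/-- The point-graph of the quadric: two distinct points are adjacent when they lie on a line
contained in the quadric. -/
def pointGraph (Q : QuadraticForm K V) : SimpleGraph (Point Q) where
  Adj X Y := X ≠ Y ∧ ∃ L : Submodule K V,
    IsSpace 1 L ∧ ContainedIn Q L ∧ X.space ≤ L ∧ Y.space ≤ L
  symm := ⟨fun _ _ h => ⟨h.1.symm, h.2.imp fun _ hL => ⟨hL.1, hL.2.1, hL.2.2.2, hL.2.2.1⟩⟩⟩
  loopless := ⟨fun _ h => h.1 rfl⟩

/-- Points of type (i) with respect to the subspace `α`: the points in `α`. -/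
def typeOne (Q : QuadraticForm K V) (α : Submodule K V) : Set (Point Q) :=
  {X | X.space ≤ α}

/-- Points of type (ii) with respect to the `s`-space `α`: points of the quadric outside `α` that
lie in some `(s+1)`-space that contains `α` and is contained in the quadric. -/
def typeTwo (Q : QuadraticForm K V) (s : ℕ) (α : Submodule K V) : Set (Point Q) :=
  {X | ¬ X.space ≤ α ∧ ∃ W : Submodule K V,
    IsSpace (s + 1) W ∧ α ≤ W ∧ ContainedIn Q W ∧ X.space ≤ W}

/-- Points of type (iii): the remaining points of the quadric. -/
def typeThree (Q : QuadraticForm K V) (s : ℕ) (α : Submodule K V) : Set (Point Q) :=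
  (typeOne Q α ∪ typeTwo Q s α)ᶜ

end Quadric

namespace GodsilMcKay

variable {P : Type*}

/-- The vertex `R` lies outside `X` and exactly half of the vertices of `X` are neighbours
of `R`. -/
def IsHalf (G : SimpleGraph P) (X : Set P) (R : P) : Prop :=
  R ∉ X ∧ 2 * (G.neighborSet R ∩ X).ncard = X.ncard

/-- One of `u`, `v` is in `X` and the other one is outside `X` and adjacent to half of `X`. -/
def IsSwitched (G : SimpleGraph P) (X : Set P) (u v : P) : Prop :=
  (u ∈ X ∧ IsHalf G X v) ∨ (v ∈ X ∧ IsHalf G X u)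

/-- The Godsil–McKay construction for the vertex partition into `X` and its complement: for each
vertex `R` outside `X` with exactly half of `X` as neighbours in `X`, the edges from `R` to `X` are
deleted and `R` is joined to the other half of `X`; all other edges are kept. -/
def switch (G : SimpleGraph P) (X : Set P) : SimpleGraph P where
  Adj u v := (IsSwitched G X u v ∧ ¬ G.Adj u v) ∨ (¬ IsSwitched G X u v ∧ G.Adj u v)
  symm := ⟨fun u v h => by
    have hs : IsSwitched G X v u ↔ IsSwitched G X u v := or_comm
    rwa [hs, G.adj_comm v u]⟩
  loopless := ⟨fun u h => by
    rcases h with ⟨h, -⟩ | ⟨-, h⟩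
    · rcases h with h | h <;> exact h.2.1 h.1
    · exact G.loopless.irrefl u h⟩

end GodsilMcKay

namespace Quadric

variable {K V : Type*} [Field K] [AddCommGroup V] [Module K V]

/-- The graph obtained from the point-graph of the quadric by the Godsil–McKay construction with
the partition into the points of type (ii) and the points of types (i) and (iii), with respect to
the `s`-space `α` contained in the quadric. -/
def newGraph (Q : QuadraticForm K V) (s : ℕ) (α : Submodule K V) : SimpleGraph (Point Q) :=
  GodsilMcKay.switch (pointGraph Q) (typeTwo Q s α)

end Quadric

end

/-!
The polar form of `Q` is written `B`, and points of the quadric are identified with nonzero singular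
vectors, which is possible over the field of two elements. Two points are then adjacent exactly
when they are distinct and orthogonal, and the maximal cliques of the point-graph, in either sense,
are the generators: the maximal subspaces contained in the quadric, all of vector dimension `g + 1`.
A point is of type (ii) if it lies in `α^⊥` but not in `α`, and of type (iii) if it does not lie in
`α^⊥`. Translation by a vector of `α` that is not orthogonal to a point `R` of type (iii) shows that
`R` is adjacent to exactly half of the points of type (ii), so switching negates orthogonality
between types (ii) and (iii) (`newGraph_adj`). If `α` is a single point `a`, adding `a` to the points
of type (ii) has the same effect on the edges, whence the isomorphism (`exists_iso_newGraph`).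

For `s ≥ 1` both clique counts are compared with the number of generators. To a generator `W` is
attached the set `switchedSpace Q α W`: the vectors of `W` that are not of type (ii), together with
the vectors `x` of type (ii) such that `B x y = 0` holds for exactly those `y ∈ W` that lie in `α^⊥`.
It is a maximal clique of the switched graph, and it determines `W`.

* Some inclusion-maximal clique is not of this form: a vector `c` of type (ii) and three vectors of
  a generator, of type (iii), none orthogonal to `c`, whose sum lies in `α^⊥`, cannot lie in one set
  `switchedSpace Q α W`, as `c` is not orthogonal to their sum
  (`exists_newOrth_not_subset_switchedSpace`). So there are more maximal cliques than generators.
* Every clique of maximum size is of this form (`exists_subset_switchedSpace`, by counting vectors),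
  but a generator disjoint from `α`, which exists by `IsGenerator.exists_inf_eq_bot`, gives a clique
  that is too small. So there are fewer maximum cliques than generators.

The strict inequality for inclusion-maximal cliques also excludes an isomorphism when `s ≥ 1`.
-/

/-! ### Orthogonality and generators of a quadric -/

namespace Quadric

open Module QuadraticMap

section Field

variable {K V : Type*} [Field K] [AddCommGroup V] [Module K V] {Q : QuadraticForm K V}

/-- The orthogonal space of `U` with respect to the polar form of `Q`. -/
def perp (Q : QuadraticForm K V) (U : Submodule K V) : Submodule K V where
  carrier := {v | ∀ u ∈ U, polar Q u v = 0}
  add_mem' hv hw u hu := by rw [polar_add_right, hv u hu, hw u hu, add_zero]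
  zero_mem' u _ := polar_zero_right Q u
  smul_mem' c v hv u hu := by rw [polar_smul_right, hv u hu, smul_zero]

theorem polar_eq_zero_of_mem_perp {U : Submodule K V} {u v : V} (hu : u ∈ U)
    (hv : v ∈ perp Q U) : polar Q v u = 0 := by
  rw [polar_comm]; exact hv u hu

theorem perp_anti {U W : Submodule K V} (h : U ≤ W) : perp Q W ≤ perp Q U :=
  fun _ hv u hu => hv u (h hu)

theorem ContainedIn.mono {U W : Submodule K V} (hW : ContainedIn Q W) (h : U ≤ W) :
    ContainedIn Q U := fun v hv => hW v (h hv)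

theorem ContainedIn.le_perp {W : Submodule K V} (hW : ContainedIn Q W) : W ≤ perp Q W := by
  intro v hv u hu
  rw [polar, hW _ (W.add_mem hu hv), hW u hu, hW v hv]
  simp

theorem ContainedIn.polar_eq_zero {W : Submodule K V} (hW : ContainedIn Q W) {u v : V}
    (hu : u ∈ W) (hv : v ∈ W) : polar Q u v = 0 := hW.le_perp hv u hu

theorem ContainedIn.sup {U W : Submodule K V} (hU : ContainedIn Q U) (hW : ContainedIn Q W)
    (h : W ≤ perp Q U) : ContainedIn Q (U ⊔ W) := by
  intro v hv
  obtain ⟨u, hu, w, hw, rfl⟩ := Submodule.mem_sup.1 hv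
  rw [QuadraticMap.map_add Q, hU u hu, hW w hw, h hw u hu]
  simp

theorem containedIn_span_singleton {v : V} (hv : Q v = 0) :
    ContainedIn Q (Submodule.span K {v}) := by
  intro w hw
  obtain ⟨c, rfl⟩ := Submodule.mem_span_singleton.1 hw
  rw [QuadraticMap.map_smul, hv, smul_zero]

theorem span_singleton_le_perp {U : Submodule K V} {v : V} (hv : v ∈ perp Q U) :
    Submodule.span K {v} ≤ perp Q U := by
  simpa using hv

/-- Pairwise orthogonal singular vectors span a subspace of the quadric. -/
theorem containedIn_span {S : Set V} (h0 : ∀ v ∈ S, Q v = 0)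
    (h : ∀ u ∈ S, ∀ v ∈ S, polar Q u v = 0) : ContainedIn Q (Submodule.span K S) := by
  have h1 : ∀ u ∈ S, ∀ v ∈ Submodule.span K S, polar Q u v = 0 := by
    intro u hu v hv
    induction hv using Submodule.span_induction with
    | mem v hv => exact h u hu v hv
    | zero => exact polar_zero_right Q u
    | add v w _ _ hv hw => rw [polar_add_right, hv, hw, add_zero]
    | smul c v _ hv => rw [polar_smul_right, hv, smul_zero]
  intro v hv
  induction hv using Submodule.span_induction with
  | mem v hv => exact h0 v hv
  | zero => exact QuadraticMap.map_zero Q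
  | add v w hv' hw' hv hw =>
    have : polar Q v w = 0 := by
      clear hv hw
      induction hv' using Submodule.span_induction with
      | mem v hv => exact h1 v hv w hw'
      | zero => exact polar_zero_left Q w
      | add x y _ _ hx hy => rw [polar_add_left, hx, hy, add_zero]
      | smul c x _ hx => rw [polar_smul_left, hx, smul_zero]
    rw [QuadraticMap.map_add Q, hv, hw, this]; simp
  | smul c v _ hv => rw [QuadraticMap.map_smul, hv, smul_zero]

/-- A generator of the quadric: a maximal subspace contained in it. -/
abbrev IsGenerator (Q : QuadraticForm K V) (W : Submodule K V) : Prop :=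
  Maximal (ContainedIn Q) W

theorem IsGenerator.mem {W : Submodule K V} (hW : IsGenerator Q W) {v : V} (hv : Q v = 0)
    (h : v ∈ perp Q W) : v ∈ W := by
  have := hW.2 (hW.1.sup (containedIn_span_singleton hv) (span_singleton_le_perp h)) le_sup_left
  exact this (Submodule.mem_sup_right (Submodule.mem_span_singleton_self v))

variable [FiniteDimensional K V]

/-- The exchange property behind Witt's theorem on the dimension of generators.  The vectors of
`W` induce functionals on `U` that vanish on `U ⊓ W`, hence too few of them to be separated
if `W` has larger dimension than `U`. -/
theorem ContainedIn.exists_mem_perp {U W : Submodule K V} (hW : ContainedIn Q W)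
    (h : finrank K U < finrank K W) : ∃ w ∈ W, w ∉ U ∧ w ∈ perp Q U := by
  by_contra! hcon
  let f : W →ₗ[K] Module.Dual K U := (Q.polarBilin.domRestrict₁₂ W U)
  have hf : ∀ (w : W) (u : U), f w u = polar Q w.1 u.1 := fun _ _ => rfl
  have hker : finrank K (LinearMap.ker f) ≤ finrank K (U.comap W.subtype) := by
    apply Submodule.finrank_mono
    intro w hw
    by_contra hwU
    refine hcon w.1 w.2 hwU fun u hu => ?_
    rw [polar_comm, ← hf w ⟨u, hu⟩, LinearMap.mem_ker.1 hw]
    rfl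
  have hrange : finrank K (LinearMap.range f) ≤
      finrank K (W.comap U.subtype).dualAnnihilator := by
    apply Submodule.finrank_mono
    rintro _ ⟨w, rfl⟩
    rw [Submodule.mem_dualAnnihilator]
    intro u hu
    exact hW.polar_eq_zero w.2 hu
  have h1 := LinearMap.finrank_range_add_finrank_ker f
  have h2 := Subspace.finrank_add_finrank_dualAnnihilator_eq (W.comap U.subtype)
  have h3 : finrank K (U.comap W.subtype) = finrank K (W.comap U.subtype) := by
    rw [← Submodule.finrank_map_subtype_eq W, ← Submodule.finrank_map_subtype_eq U,
      Submodule.map_comap_subtype, Submodule.map_comap_subtype, inf_comm]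
  omega

theorem ContainedIn.exists_isGenerator {U : Submodule K V} (hU : ContainedIn Q U) :
    ∃ W, IsGenerator Q W ∧ U ≤ W := by
  obtain ⟨W, hUW, hW⟩ := exists_maximal_ge_of_wellFoundedGT (ContainedIn Q) U hU
  exact ⟨W, hW, hUW⟩

theorem IsGenerator.finrank_le {U W : Submodule K V} (hW : IsGenerator Q W)
    (hU : ContainedIn Q U) : finrank K U ≤ finrank K W := by
  by_contra! h
  obtain ⟨u, hu, huW, hp⟩ := hU.exists_mem_perp h
  exact huW (hW.mem (hU u hu) hp)

theorem IsGenerator.of_finrank_le {U W : Submodule K V} (hW : IsGenerator Q W)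
    (hU : ContainedIn Q U) (h : finrank K W ≤ finrank K U) : IsGenerator Q U :=
  ⟨hU, fun _ hU' hle =>
    (Submodule.eq_of_le_of_finrank_le hle ((hW.finrank_le hU').trans h)).ge⟩

/-- A subspace of the quadric is a generator as soon as it absorbs the vectors of one
generator that are orthogonal to it. -/
theorem IsGenerator.of_forall_mem {U W : Submodule K V} (hW : IsGenerator Q W)
    (hU : ContainedIn Q U) (h : ∀ w ∈ W, w ∈ perp Q U → w ∈ U) : IsGenerator Q U := by
  refine hW.of_finrank_le hU ?_
  by_contra! hlt
  obtain ⟨w, hw, hwU, hp⟩ := hW.1.exists_mem_perp hlt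
  exact hwU (h w hw hp)

theorem IsGenerator.finrank_eq {g : ℕ} (hg : HasProjectiveIndex Q g) {W : Submodule K V}
    (hW : IsGenerator Q W) : finrank K W = g + 1 := by
  obtain ⟨⟨U, hU, hUQ⟩, hmax⟩ := hg
  have h1 := hW.finrank_le hUQ
  rw [hU] at h1
  obtain ⟨d, hd⟩ : ∃ d, finrank K W = d + 1 := ⟨finrank K W - 1, by omega⟩
  have := hmax ⟨W, hd, hW.1⟩
  omega

/-- The points of a generator `W` that are orthogonal to a smaller subspace `α` of the quadric
do not all lie in `α`. -/
theorem IsGenerator.exists_mem_perp {α W : Submodule K V} (hW : IsGenerator Q W)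
    (h : ¬ IsGenerator Q α) (hα : ContainedIn Q α) : ∃ w ∈ W, w ∉ α ∧ w ∈ perp Q α := by
  by_contra! hcon
  exact h (hW.of_forall_mem hα fun w hw hp => by_contra fun hwα => hcon w hw hwα hp)

/-- Replacing the vectors of `W` outside `α^⊥` by `α` turns a generator into a generator. -/
theorem IsGenerator.inf_perp_sup {α W : Submodule K V} (hW : IsGenerator Q W)
    (hα : ContainedIn Q α) : IsGenerator Q (α ⊔ (W ⊓ perp Q α)) := by
  refine hW.of_forall_mem (hα.sup (hW.1.mono inf_le_left) inf_le_right) fun w hw hp => ?_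
  exact Submodule.mem_sup_right ⟨hw, perp_anti le_sup_left hp⟩

end Field

end Quadric

/-! ### Generators of a non-singular quadric -/

namespace Quadric

open Module QuadraticMap

section Field

variable {K V : Type*} [Field K] [AddCommGroup V] [Module K V] {Q : QuadraticForm K V}
  [FiniteDimensional K V]

/-- If a singular vector `x` were orthogonal to all of `α^⊥`, the functional it induces would also
be induced by some `a ∈ α`, and `x - a` would lie in the radical. -/
theorem exists_mem_perp_polar_ne_zero (hQ : IsNonsingular Q) {α : Submodule K V}
    (hα : ContainedIn Q α) {x : V} (hx : Q x = 0) (hxα : x ∉ α) (hxp : x ∈ perp Q α) :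
    ∃ c ∈ perp Q α, Q c = 0 ∧ polar Q c x ≠ 0 := by
  obtain ⟨v, hv, hvx⟩ : ∃ v ∈ perp Q α, polar Q v x ≠ 0 := by
    by_contra! hcon
    have hR : Q.polarBilin x ∈ (α.map Q.polarBilin).dualCoannihilator.dualAnnihilator := by
      rw [Submodule.mem_dualAnnihilator]
      intro v hv
      rw [polarBilin_apply_apply, polar_comm]
      refine hcon v fun u hu => ?_
      exact (Submodule.mem_dualCoannihilator v).1 hv _ (Submodule.mem_map_of_mem hu)
    rw [Subspace.dualCoannihilator_dualAnnihilator_eq] at hR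
    obtain ⟨a, ha, hax⟩ := hR
    have h0 : x - a ∈ Q.radical := by
      rw [mem_radical_iff']
      have h1 : ∀ n, polar Q (x - a) n = 0 := fun n => by
        have := congrArg (fun f : V →ₗ[K] K => f n) hax
        simp only [polarBilin_apply_apply] at this
        rw [polar_sub_left, this, sub_self]
      have h2 : Q (x - a) = 0 := by
        rw [sub_eq_add_neg, QuadraticMap.map_add Q, QuadraticMap.map_neg, polar_neg_right, hx,
          hα a ha, polar_eq_zero_of_mem_perp ha hxp]
        simp
      exact ⟨h2, fun n => by rw [QuadraticMap.map_add Q, h1, h2]; simp⟩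
    rw [show Q.radical = ⊥ from hQ, Submodule.mem_bot, sub_eq_zero] at h0
    exact hxα (h0 ▸ ha)
  refine ⟨v + (-(Q v / polar Q v x)) • x, ?_, ?_, ?_⟩
  · exact Submodule.add_mem _ hv (Submodule.smul_mem _ _ hxp)
  · rw [QuadraticMap.map_add Q, QuadraticMap.map_smul, hx, polar_smul_right, smul_eq_mul,
      smul_eq_mul]
    field_simp
    ring
  · rw [polar_add_left, polar_smul_left, polar_self, hx]
    simpa using hvx

/-- Every subspace `α` of a non-singular quadric has a generator disjoint from it: exchanging
the part of a generator outside `p^⊥` for a singular vector `p` that is not orthogonal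
to some `a ∈ W ⊓ α` makes the intersection with `α` smaller. -/
theorem IsGenerator.exists_inf_eq_bot (hQ : IsNonsingular Q) {α : Submodule K V}
    (hα : ContainedIn Q α) : ∃ W, IsGenerator Q W ∧ W ⊓ α = ⊥ := by
  suffices h : ∀ n, ∀ W, IsGenerator Q W → finrank K ↥(W ⊓ α) = n →
      ∃ W, IsGenerator Q W ∧ W ⊓ α = ⊥ by
    obtain ⟨W, hW, -⟩ := hα.exists_isGenerator
    exact h _ W hW rfl
  intro n
  induction n using Nat.strong_induction_on with
  | _ n ih =>
  intro W hW hn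
  by_cases hbot : W ⊓ α = ⊥
  · exact ⟨W, hW, hbot⟩
  obtain ⟨a, ⟨haW, haα⟩, ha0⟩ := Submodule.exists_mem_ne_zero_of_ne_bot hbot
  obtain ⟨p, -, hp, hpa⟩ := exists_mem_perp_polar_ne_zero hQ (α := ⊥) (x := a)
    (fun v hv => by rw [(Submodule.mem_bot K).1 hv, QuadraticMap.map_zero]) (hα a haα)
    (by simpa using ha0) (fun u hu => by rw [(Submodule.mem_bot K).1 hu, polar_zero_left])
  have hpp : Submodule.span K {p} ≤ perp Q (W ⊓ perp Q (Submodule.span K {p})) :=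
    span_singleton_le_perp fun u hu => polar_eq_zero_of_mem_perp
      (Submodule.mem_span_singleton_self p) hu.2
  -- A vector of the new generator that is orthogonal to `a` already lies in the old one.
  have key : ∀ x ∈ W ⊓ perp Q (Submodule.span K {p}) ⊔ Submodule.span K {p},
      polar Q x a = 0 → x ∈ W ⊓ perp Q (Submodule.span K {p}) := by
    intro x hx hxa
    obtain ⟨u, hu, w, hw, rfl⟩ := Submodule.mem_sup.1 hx
    obtain ⟨c, rfl⟩ := Submodule.mem_span_singleton.1 hw
    rw [polar_add_left, hW.1.polar_eq_zero hu.1 haW, polar_smul_left, zero_add, smul_eq_mul,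
      mul_eq_zero, or_iff_left hpa] at hxa
    simpa [hxa] using hu
  have hgen : IsGenerator Q (W ⊓ perp Q (Submodule.span K {p}) ⊔ Submodule.span K {p}) := by
    refine hW.of_forall_mem ((hW.1.mono inf_le_left).sup (containedIn_span_singleton hp) hpp)
      fun w hw hwp => ?_
    exact Submodule.mem_sup_left ⟨hw, perp_anti le_sup_right hwp⟩
  refine ih _ ?_ _ hgen rfl
  rw [← hn]
  apply Submodule.finrank_lt_finrank_of_lt
  refine lt_of_le_of_ne (fun x hx => ⟨(key x hx.1 (hα.polar_eq_zero hx.2 haα)).1, hx.2⟩) fun h => ?_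
  have ha : a ∈ W ⊓ α := ⟨haW, haα⟩
  rw [← h] at ha
  exact hpa ((key a ha.1 (hα.polar_eq_zero haα haα)).2 p (Submodule.mem_span_singleton_self p))

end Field

/-! ### Switched orthogonality of vectors over the field of two elements -/

section Two

variable {V : Type*} [AddCommGroup V] [Module (ZMod 2) V]
  {Q : QuadraticForm (ZMod 2) V} {α : Submodule (ZMod 2) V}

theorem eq_one_of_ne_zero {t : ZMod 2} (h : t ≠ 0) : t = 1 := by
  revert t; decide

/-- Of two vectors, one is of type (ii) and the other one is not orthogonal to `α`.  For
singular vectors this says that the corresponding pair of points is switched. -/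
def Switched (Q : QuadraticForm (ZMod 2) V) (α : Submodule (ZMod 2) V) (u v : V) : Prop :=
  (u ∈ perp Q α ∧ u ∉ α ∧ v ∉ perp Q α) ∨ (v ∈ perp Q α ∧ v ∉ α ∧ u ∉ perp Q α)

/-- The relation between vectors that is orthogonality for pairs that are not switched
and its negation for switched pairs. -/
def NewOrth (Q : QuadraticForm (ZMod 2) V) (α : Submodule (ZMod 2) V) (u v : V) : Prop :=
  polar Q u v = 0 ↔ ¬ Switched Q α u v

theorem NewOrth.symm {u v : V} (h : NewOrth Q α u v) : NewOrth Q α v u := by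
  unfold NewOrth Switched at *
  rw [polar_comm]
  tauto

theorem NewOrth.polar_eq_zero {u v : V} (h : NewOrth Q α u v) (hs : ¬ Switched Q α u v) :
    polar Q u v = 0 := h.2 hs

theorem NewOrth.polar_eq_one {u v : V} (h : NewOrth Q α u v) (hu : u ∈ perp Q α) (huα : u ∉ α)
    (hv : v ∉ perp Q α) : polar Q u v = 1 :=
  eq_one_of_ne_zero fun h0 => h.1 h0 (Or.inl ⟨hu, huα, hv⟩)

theorem newOrth_of_mem_perp {u v : V} (hu : u ∈ perp Q α) (hv : v ∈ perp Q α)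
    (h : polar Q u v = 0) : NewOrth Q α u v := by
  unfold NewOrth Switched
  tauto

theorem newOrth_of_notMem_perp {u v : V} (hu : u ∉ perp Q α) (hv : v ∉ perp Q α)
    (h : polar Q u v = 0) : NewOrth Q α u v := by
  unfold NewOrth Switched
  tauto

theorem newOrth_of_polar_ne_zero {u v : V} (hu : u ∈ perp Q α) (huα : u ∉ α) (hv : v ∉ perp Q α)
    (h : polar Q u v ≠ 0) : NewOrth Q α u v := by
  unfold NewOrth Switched
  tauto

/-- The vectors of the clique of the switched graph that replaces the generator `W`: those
vectors of `W` that are not of type (ii), and the vectors of type (ii) that are orthogonal to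
precisely those vectors of `W` that are orthogonal to `α`. -/
def switchedSpace (Q : QuadraticForm (ZMod 2) V) (α W : Submodule (ZMod 2) V) : Set V :=
  {v | (v ∈ perp Q α ∧ v ∉ α ∧ ∀ y ∈ W, (polar Q v y = 0 ↔ y ∈ perp Q α)) ∨
    (v ∈ W ∧ (v ∈ perp Q α → v ∈ α))}

theorem mem_switchedSpace_of_notMem {W : Submodule (ZMod 2) V} {v : V} (hv : v ∈ W)
    (h : v ∉ perp Q α) : v ∈ switchedSpace Q α W := Or.inr ⟨hv, fun h' => absurd h' h⟩

theorem add_mem_notMem_perp {W : Submodule (ZMod 2) V} {y z : V} (hy : y ∈ W) (hz : z ∈ W)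
    (hyp : y ∈ perp Q α) (hzp : z ∉ perp Q α) : y + z ∈ W ∧ y + z ∉ perp Q α :=
  ⟨W.add_mem hy hz, fun h => hzp (by simpa using Submodule.sub_mem _ h hyp)⟩

theorem IsGenerator.le_of_le_perp {W : Submodule (ZMod 2) V} (hW : IsGenerator Q W)
    (hα : ContainedIn Q α) (h : W ≤ perp Q α) : α ≤ W :=
  fun a ha => hW.mem (hα a ha) fun _ hu => polar_eq_zero_of_mem_perp ha (h hu)

/-- A generator that contains `α` is unchanged. -/
theorem IsGenerator.switchedSpace_eq {W : Submodule (ZMod 2) V} (hW : IsGenerator Q W)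
    (h : W ≤ perp Q α) {v : V} (hv : Q v = 0) :
    v ∈ switchedSpace Q α W ↔ v ∈ W := by
  constructor
  · rintro (⟨-, -, h'⟩ | h')
    · refine hW.mem hv fun y hy => ?_
      rw [polar_comm]
      exact (h' y hy).2 (h hy)
    · exact h'.1
  · intro hvW
    by_cases hvα : v ∈ α
    · exact Or.inr ⟨hvW, fun _ => hvα⟩
    · exact Or.inl ⟨h hvW, hvα, fun y hy => ⟨fun _ => h hy, fun _ => hW.1.polar_eq_zero hvW hy⟩⟩

theorem IsGenerator.newOrth_of_mem [FiniteDimensional (ZMod 2) V] {W : Submodule (ZMod 2) V}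
    (hW : IsGenerator Q W) (hα : ContainedIn Q α) {u v : V} (hu : Q u = 0) (hv : Q v = 0)
    (huW : u ∈ switchedSpace Q α W) (hvW : v ∈ switchedSpace Q α W) : NewOrth Q α u v := by
  -- Vectors of type (ii) in `switchedSpace Q α W` lie in the generator `α ⊔ (W ⊓ α^⊥)`.
  have key : ∀ x, Q x = 0 → x ∈ perp Q α → (∀ y ∈ W, (polar Q x y = 0 ↔ y ∈ perp Q α)) →
      x ∈ α ⊔ (W ⊓ perp Q α) := by
    intro x hx hxp hxW
    refine (hW.inf_perp_sup hα).mem hx fun y hy => ?_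
    obtain ⟨a, ha, w, hw, rfl⟩ := Submodule.mem_sup.1 hy
    rw [polar_add_left, hxp a ha, zero_add, polar_comm]
    exact (hxW w hw.1).2 hw.2
  have mixed : ∀ u v, (u ∈ perp Q α ∧ u ∉ α ∧ ∀ y ∈ W, (polar Q u y = 0 ↔ y ∈ perp Q α)) →
      (v ∈ W ∧ (v ∈ perp Q α → v ∈ α)) → NewOrth Q α u v := by
    intro u v h1 h2
    have := h1.2.2 v h2.1
    unfold NewOrth Switched
    tauto
  rcases huW with h1 | h1 <;> rcases hvW with h2 | h2
  · have := (hW.inf_perp_sup hα).1.polar_eq_zero (key u hu h1.1 h1.2.2) (key v hv h2.1 h2.2.2)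
    unfold NewOrth Switched
    tauto
  · exact mixed u v h1 h2
  · exact (mixed v u h2 h1).symm
  · have := hW.1.polar_eq_zero h1.1 h2.1
    unfold NewOrth Switched
    tauto

/-- The set that replaces a generator cannot be enlarged to a bigger clique. -/
theorem IsGenerator.mem_switchedSpace {W : Submodule (ZMod 2) V}
    (hW : IsGenerator Q W) (hα : ContainedIn Q α) {v : V} (hv : Q v = 0)
    (h : ∀ u ∈ switchedSpace Q α W, u ≠ 0 → Q u = 0 → NewOrth Q α u v) :
    v ∈ switchedSpace Q α W := by
  by_cases hWp : W ≤ perp Q α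
  · have hαW := hW.le_of_le_perp hα hWp
    have h' : ∀ u ∈ W, u ≠ 0 → NewOrth Q α u v := fun u hu hu0 =>
      h u ((hW.switchedSpace_eq hWp (hW.1 u hu)).2 hu) hu0 (hW.1 u hu)
    have hvp : v ∈ perp Q α := by
      intro a ha
      by_cases ha0 : a = 0
      · rw [ha0, polar_zero_left]
      by_contra hne
      have h1 := h' a (hαW ha) ha0
      have h2 := mt (fun hp : v ∈ perp Q α => hp a ha) hne
      unfold NewOrth Switched at h1
      tauto
    rw [hW.switchedSpace_eq hWp hv]
    refine hW.mem hv fun y hy => ?_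
    by_cases hy0 : y = 0
    · rw [hy0, polar_zero_left]
    have h1 := h' y hy hy0
    have h2 := hWp hy
    unfold NewOrth Switched at h1
    tauto
  · obtain ⟨z, hz, hzp⟩ := Set.not_subset.1 hWp
    have h' : ∀ u ∈ W, u ∉ perp Q α → NewOrth Q α u v := fun u hu hup =>
      h u (mem_switchedSpace_of_notMem hu hup) (fun h0 => hup (h0 ▸ Submodule.zero_mem _))
        (hW.1 u hu)
    by_cases hvX : v ∈ perp Q α ∧ v ∉ α
    · have h1 : ∀ y ∈ W, y ∉ perp Q α → polar Q v y ≠ 0 := by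
        intro y hy hyp
        have := h' y hy hyp
        rw [polar_comm]
        unfold NewOrth Switched at this
        tauto
      refine Or.inl ⟨hvX.1, hvX.2, fun y hy => ⟨fun h0 => by_contra fun hyp => h1 y hy hyp h0,
        fun hyp => ?_⟩⟩
      obtain ⟨h2, h3⟩ := add_mem_notMem_perp hy hz hyp hzp
      have h4 := eq_one_of_ne_zero (h1 _ h2 h3)
      rwa [polar_add_right, eq_one_of_ne_zero (h1 _ hz hzp), add_eq_right] at h4
    · have h1 : ∀ y ∈ W, y ∉ perp Q α → polar Q y v = 0 := by
        intro y hy hyp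
        have := h' y hy hyp
        unfold NewOrth Switched at this
        tauto
      refine Or.inr ⟨hW.mem hv fun y hy => ?_, fun hvp => by tauto⟩
      by_cases hyp : y ∈ perp Q α
      · obtain ⟨h2, h3⟩ := add_mem_notMem_perp hy hz hyp hzp
        have h4 := h1 _ h2 h3
        rwa [polar_add_left, h1 _ hz hzp, add_zero] at h4
      · exact h1 y hy hyp

/-- A generator can be recovered from the set that replaces it. -/
theorem IsGenerator.le_of_switchedSpace_subset {W W' : Submodule (ZMod 2) V}
    (hW : IsGenerator Q W) (hW' : IsGenerator Q W') (hα : ContainedIn Q α)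
    (h : ∀ v ∈ switchedSpace Q α W, v ≠ 0 → Q v = 0 → v ∈ switchedSpace Q α W') : W ≤ W' := by
  by_cases hWp : W ≤ perp Q α
  · have h' : ∀ v ∈ W, v ∈ switchedSpace Q α W' := fun v hv => by
      by_cases h0 : v = 0
      · exact Or.inr ⟨h0 ▸ Submodule.zero_mem _, fun _ => h0 ▸ Submodule.zero_mem _⟩
      · exact h v ((hW.switchedSpace_eq hWp (hW.1 v hv)).2 hv) h0 (hW.1 v hv)
    have hα' : α ≤ W' := fun a ha => by
      rcases h' a (hW.le_of_le_perp hα hWp ha) with h1 | h1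
      · exact absurd ha h1.2.1
      · exact h1.1
    have hWp' : W' ≤ perp Q α := hW'.1.le_perp.trans (perp_anti hα')
    exact fun v hv => (hW'.switchedSpace_eq hWp' (hW.1 v hv)).1 (h' v hv)
  · obtain ⟨z, hz, hzp⟩ := Set.not_subset.1 hWp
    have h' : ∀ v ∈ W, v ∉ perp Q α → v ∈ W' := fun v hv hvp => by
      rcases h v (mem_switchedSpace_of_notMem hv hvp)
        (fun h0 => hvp (h0 ▸ Submodule.zero_mem _)) (hW.1 v hv) with h1 | h1
      · exact absurd h1.1 hvp
      · exact h1.1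
    intro y hy
    by_cases hyp : y ∈ perp Q α
    · obtain ⟨h2, h3⟩ := add_mem_notMem_perp hy hz hyp hzp
      simpa using W'.sub_mem (h' _ h2 h3) (h' z hz hzp)
    · exact h' y hy hyp

/-- A generator disjoint from `α` induces all functionals on `α`, so that it contains two vectors
that induce distinct nonzero functionals once `α` is more than a point. -/
theorem IsGenerator.exists_add_notMem_perp {W : Submodule (ZMod 2) V} (hW : IsGenerator Q W)
    (hα : ContainedIn Q α) (hWα : W ⊓ α = ⊥) (h2 : 1 < finrank (ZMod 2) α) :
    ∃ b ∈ W, ∃ b' ∈ W, b ∉ perp Q α ∧ b' ∉ perp Q α ∧ b + b' ∉ perp Q α := by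
  have key : ∀ a ∈ α, a ≠ 0 → ∃ b ∈ W, polar Q a b = 1 := by
    intro a ha ha0
    by_contra! hcon
    have : a ∈ W := hW.mem (hα a ha) fun u hu => by
      by_contra hne
      rw [polar_comm] at hne
      exact hcon u hu (eq_one_of_ne_zero hne)
    exact ha0 ((Submodule.mem_bot _).1 (hWα.le ⟨this, ha⟩))
  have : Nontrivial α := Module.nontrivial_of_finrank_pos (by omega : 0 < finrank (ZMod 2) α)
  obtain ⟨⟨a, ha⟩, ha0⟩ := exists_ne (0 : α)
  have ha0' : a ≠ 0 := fun h => ha0 (Subtype.ext h)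
  obtain ⟨a', ha', haa'⟩ : ∃ a' ∈ α, a' ∉ Submodule.span (ZMod 2) {a} := by
    by_contra! hcon
    have := Submodule.finrank_mono (show α ≤ Submodule.span (ZMod 2) {a} from hcon)
    rw [finrank_span_singleton ha0'] at this
    omega
  obtain ⟨b, hb, hab⟩ := key a ha ha0'
  obtain ⟨b', hb', hab'⟩ := key a' ha' fun h => haa' (h ▸ Submodule.zero_mem _)
  obtain ⟨c, hc, hac⟩ := key (a + a') (α.add_mem ha ha') fun h => haa' (by
    rw [eq_neg_of_add_eq_zero_right h]
    exact Submodule.neg_mem _ (Submodule.mem_span_singleton_self a))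
  have hp : ∀ x a, a ∈ α → polar Q a x = 1 → x ∉ perp Q α := fun x a ha h1 h0 => by
    rw [h0 a ha] at h1; exact zero_ne_one h1
  by_contra! hcon
  have h1 := hcon b hb b' hb' (hp b a ha hab) (hp b' a' ha' hab') a' ha'
  have h3 := hcon b hb c hc (hp b a ha hab) (hp c _ (α.add_mem ha ha') hac) (a + a')
    (α.add_mem ha ha')
  simp only [polar_add_right, polar_add_left] at h1 h3 hac
  rw [hab'] at h1
  rw [hab, hac] at h3
  revert h1 h3
  generalize polar Q a' b = t
  revert t
  decide

/-- The set that replaces a generator disjoint from `α` is a proper part of it. -/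
theorem IsGenerator.switchedSpace_subset_of_inf_eq_bot {W : Submodule (ZMod 2) V}
    (hW : IsGenerator Q W) (hα : ContainedIn Q α) (hWα : W ⊓ α = ⊥)
    (h2 : 1 < finrank (ZMod 2) α) {v : V} (hv : v ∈ switchedSpace Q α W) :
    v ∈ W ∧ (v ∈ perp Q α → v ∈ α) := by
  rcases hv with ⟨-, -, hv⟩ | hv
  · obtain ⟨b, hb, b', hb', h1, h1', h3⟩ := hW.exists_add_notMem_perp hα hWα h2
    refine absurd ?_ h3
    rw [← hv _ (W.add_mem hb hb'), polar_add_right,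
      eq_one_of_ne_zero (mt (hv b hb).1 h1), eq_one_of_ne_zero (mt (hv b' hb').1 h1')]
    decide
  · exact hv

/-- A clique of the switched graph that is not contained in any of the cliques replacing the
generators.  It consists of a vector `c` of type (ii) and three vectors of a generator disjoint
from `α`, whose sum is orthogonal to `α` but not to `c`. -/
theorem exists_newOrth_not_subset_switchedSpace [FiniteDimensional (ZMod 2) V]
    (hQ : IsNonsingular Q) (hα : ContainedIn Q α) (hαg : ¬ IsGenerator Q α)
    (h2 : 1 < finrank (ZMod 2) α) :
    ∃ S : Set V, (∀ v ∈ S, v ≠ 0 ∧ Q v = 0) ∧ (∀ u ∈ S, ∀ v ∈ S, NewOrth Q α u v) ∧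
      ∀ W : Submodule (ZMod 2) V, ¬ S ⊆ switchedSpace Q α W := by
  obtain ⟨W, hW, hWα⟩ := IsGenerator.exists_inf_eq_bot hQ hα
  obtain ⟨x, hx, hxα, hxp⟩ := hW.exists_mem_perp hαg hα
  obtain ⟨c, hcp, hc, hcx⟩ := exists_mem_perp_polar_ne_zero hQ hα (hW.1 x hx) hxα hxp
  have hcα : c ∉ α := fun h => hcx (hxp c h)
  obtain ⟨b, hb, b', hb', h1, h1', h3⟩ := hW.exists_add_notMem_perp hα hWα h2
  -- Adding `x` to a vector of `W` does not change the functional it induces on `α`, but it changes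
  -- its product with `c`.
  have adjust : ∀ y ∈ W, ∃ z ∈ W, z - y ∈ perp Q α ∧ polar Q c z = 1 := by
    intro y hy
    by_cases h : polar Q c y = 0
    · exact ⟨y + x, W.add_mem hy hx, by simpa using hxp, by
        rw [polar_add_right, h, zero_add, eq_one_of_ne_zero hcx]⟩
    · exact ⟨y, hy, by simp, eq_one_of_ne_zero h⟩
  obtain ⟨d, hd, hdb, hcd⟩ := adjust b hb
  obtain ⟨d', hd', hdb', hcd'⟩ := adjust b' hb'
  obtain ⟨e, he, hde, hce⟩ := adjust (d + d') (W.add_mem hd hd')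
  have np : ∀ {z y : V}, z - y ∈ perp Q α → y ∉ perp Q α → z ∉ perp Q α := fun h hy hz =>
    hy (by simpa using Submodule.sub_mem _ hz h)
  have hdp := np hdb h1
  have hdp' := np hdb' h1'
  have hep : e ∉ perp Q α := np (y := b + b')
    (by
      have := Submodule.add_mem _ hde (Submodule.add_mem _ hdb hdb')
      rwa [show e - (d + d') + (d - b + (d' - b')) = e - (b + b') by abel] at this) h3
  have hW3 : ∀ v ∈ ({d, d', e} : Set V), v ∈ W ∧ v ∉ perp Q α ∧ polar Q c v = 1 := by
    rintro v (rfl | rfl | rfl)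
    exacts [⟨hd, hdp, hcd⟩, ⟨hd', hdp', hcd'⟩, ⟨he, hep, hce⟩]
  have hcv : ∀ v ∈ ({d, d', e} : Set V), NewOrth Q α c v := by
    intro v hv
    obtain ⟨-, h4, h5⟩ := hW3 v hv
    exact newOrth_of_polar_ne_zero hcp hcα h4 (by rw [h5]; exact one_ne_zero)
  refine ⟨insert c {d, d', e}, ?_, ?_, ?_⟩
  · intro v hv
    rcases hv with rfl | hv
    · exact ⟨fun h => hcα (h ▸ α.zero_mem), hc⟩
    · exact ⟨fun h => (hW3 v hv).2.1 (h ▸ Submodule.zero_mem _), hW.1 v (hW3 v hv).1⟩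
  · intro u hu v hv
    rcases hu with rfl | hu <;> rcases hv with rfl | hv
    · exact newOrth_of_mem_perp hcp hcp (by rw [polar_self, hc, smul_zero])
    · exact hcv v hv
    · exact (hcv u hu).symm
    · exact newOrth_of_notMem_perp (hW3 u hu).2.1 (hW3 v hv).2.1
        (hW.1.polar_eq_zero (hW3 u hu).1 (hW3 v hv).1)
  · intro U hU
    have hc' : ∀ y ∈ U, (polar Q c y = 0 ↔ y ∈ perp Q α) := by
      rcases hU (Set.mem_insert c _) with h | h
      · exact h.2.2
      · exact absurd (h.2 hcp) hcα
    have hU3 : ∀ v ∈ ({d, d', e} : Set V), v ∈ U := by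
      intro v hv
      rcases hU (Set.mem_insert_of_mem c hv) with h | h
      · exact absurd h.1 (hW3 v hv).2.1
      · exact h.1
    have h9 := (hc' (e - (d + d')) (U.sub_mem (hU3 e (by simp))
      (U.add_mem (hU3 d (by simp)) (hU3 d' (by simp))))).2 hde
    rw [polar_sub_right, polar_add_right, hce, hcd, hcd'] at h9
    revert h9
    decide

end Two

end Quadric

/-! ### Large cliques of the switched graph -/

namespace Quadric

open Module QuadraticMap

section Counting

variable {V : Type*} [AddCommGroup V] [Module (ZMod 2) V] [Finite V]
  {Q : QuadraticForm (ZMod 2) V} {α : Submodule (ZMod 2) V}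

theorem ncard_submodule (W : Submodule (ZMod 2) V) :
    (W : Set V).ncard = 2 ^ finrank (ZMod 2) W := by
  rw [← Nat.card_coe_set_eq, SetLike.coe_sort_coe, Module.natCard_eq_pow_finrank (K := ZMod 2),
    Nat.card_zmod]

/-- A proper subspace contains at most half of the vectors. -/
theorem two_mul_ncard_le {U W : Submodule (ZMod 2) V} (h : U < W) :
    2 * (U : Set V).ncard ≤ (W : Set V).ncard := by
  rw [ncard_submodule, ncard_submodule, ← pow_succ']
  exact Nat.pow_le_pow_right two_pos (Submodule.finrank_lt_finrank_of_lt h)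

/-- The part of the classification of large cliques in which the clique has a point `c` of
type (ii) and a point `d` of type (iii).  Translating by `c` and `d` moves the clique into
a totally singular subspace `T` orthogonal to both; a count shows that `T` lies
in `α^⊥` and that `T` and `d` span a generator. -/
theorem exists_subset_switchedSpace_of_mixed (hα : ContainedIn Q α) (hαg : ¬ IsGenerator Q α)
    {g : ℕ} (hg : HasProjectiveIndex Q g) {C : Set V} (hC : ∀ v ∈ C, v ≠ 0 ∧ Q v = 0)
    (hadj : ∀ u ∈ C, ∀ v ∈ C, NewOrth Q α u v) (hcard : 2 ^ (g + 1) ≤ C.ncard + 1)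
    {c d : V} (hc : c ∈ C) (hcp : c ∈ perp Q α) (hcα : c ∉ α) (hd : d ∈ C) (hdp : d ∉ perp Q α) :
    ∃ W, IsGenerator Q W ∧ C ⊆ switchedSpace Q α W := by
  have same : ∀ u ∈ C, ∀ v ∈ C, (u ∈ perp Q α ↔ v ∈ perp Q α) → polar Q u v = 0 :=
    fun u hu v hv h => (hadj u hu v hv).polar_eq_zero (by unfold Switched; tauto)
  have hone : ∀ u ∈ C, u ∈ α → ∀ v ∈ C, polar Q u v = 0 :=
    fun u hu huα v hv => (hadj u hu v hv).polar_eq_zero (by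
      have := hα.le_perp huα
      unfold Switched; tauto)
  have hmix : ∀ u ∈ C, u ∈ perp Q α → u ∉ α → ∀ v ∈ C, v ∉ perp Q α → polar Q u v = 1 :=
    fun u hu hup huα v hv hvp => (hadj u hu v hv).polar_eq_one hup huα hvp
  have hcd := hmix c hc hcp hcα d hd hdp
  -- `τ` translates the three parts of the clique by `0`, `c` and `d`.
  classical
  let τ : V → V := fun v => if v ∈ α then v else if v ∈ perp Q α then v + c else v + d
  have τ1 : ∀ v, v ∈ α → τ v = v := fun v h => if_pos h
  have τ2 : ∀ v, v ∉ α → v ∈ perp Q α → τ v = v + c := fun v h h' => by simp [τ, h, h']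
  have τ3 : ∀ v, v ∉ perp Q α → τ v = v + d := fun v h => by
    have : v ∉ α := fun h' => h (hα.le_perp h')
    simp [τ, h, this]
  have τQ : ∀ v ∈ C, Q (τ v) = 0 := by
    intro v hv
    by_cases h1 : v ∈ α
    · rw [τ1 v h1]; exact (hC v hv).2
    by_cases h2 : v ∈ perp Q α
    · rw [τ2 v h1 h2, QuadraticMap.map_add Q, (hC v hv).2, (hC c hc).2,
        same v hv c hc (by tauto)]
      simp
    · rw [τ3 v h2, QuadraticMap.map_add Q, (hC v hv).2, (hC d hd).2,
        same v hv d hd (by tauto)]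
      simp
  have τo : ∀ v ∈ C, ∀ u ∈ C, polar Q (τ v) u = 0 := by
    intro v hv u hu
    by_cases h1 : v ∈ α
    · rw [τ1 v h1]; exact hone v hv h1 u hu
    by_cases h2 : v ∈ perp Q α
    · rw [τ2 v h1 h2, polar_add_left]
      by_cases h : u ∈ perp Q α
      · rw [same v hv u hu (by tauto), same c hc u hu (by tauto), add_zero]
      · rw [hmix v hv h2 h1 u hu h, hmix c hc hcp hcα u hu h]; decide
    · rw [τ3 v h2, polar_add_left]
      by_cases huα : u ∈ α
      · rw [polar_comm, polar_comm Q d, hone u hu huα v hv, hone u hu huα d hd, add_zero]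
      by_cases h : u ∈ perp Q α
      · rw [polar_comm, polar_comm Q d, hmix u hu h huα v hv h2, hmix u hu h huα d hd hdp]; decide
      · rw [same v hv u hu (by tauto), same d hd u hu (by tauto), add_zero]
  have ττ : ∀ v ∈ C, ∀ u ∈ C, polar Q (τ v) (τ u) = 0 := by
    intro v hv u hu
    by_cases h1 : u ∈ α
    · rw [τ1 u h1]; exact τo v hv u hu
    by_cases h2 : u ∈ perp Q α
    · rw [τ2 u h1 h2, polar_add_right, τo v hv u hu, τo v hv c hc, add_zero]
    · rw [τ3 u h2, polar_add_right, τo v hv u hu, τo v hv d hd, add_zero]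
  let T : Submodule (ZMod 2) V := Submodule.span (ZMod 2) (τ '' C)
  have hτT : ∀ v ∈ C, τ v ∈ T := fun v hv => Submodule.subset_span (Set.mem_image_of_mem τ hv)
  have hT : ContainedIn Q T := by
    refine containedIn_span ?_ ?_
    · rintro _ ⟨v, hv, rfl⟩; exact τQ v hv
    · rintro _ ⟨v, hv, rfl⟩ _ ⟨u, hu, rfl⟩; exact ττ v hv u hu
  have hTC : ∀ u ∈ C, u ∈ perp Q T := by
    intro u hu
    have : T ≤ perp Q (Submodule.span (ZMod 2) {u}) := by
      refine Submodule.span_le.2 ?_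
      rintro _ ⟨v, hv, rfl⟩ w hw
      obtain ⟨k, rfl⟩ := Submodule.mem_span_singleton.1 hw
      rw [polar_comm, polar_smul_right, τo v hv u hu, smul_zero]
    intro t ht
    exact polar_eq_zero_of_mem_perp (Submodule.mem_span_singleton_self u) (this ht)
  have hdT : d ∉ T := fun h => by
    have := hTC c hc d h
    rw [polar_comm, hcd] at this
    exact one_ne_zero this
  have hWQ : ContainedIn Q (T ⊔ Submodule.span (ZMod 2) {d}) :=
    hT.sup (containedIn_span_singleton (hC d hd).2) (span_singleton_le_perp (hTC d hd))
  have hrank : finrank (ZMod 2) ↥(T ⊔ Submodule.span (ZMod 2) {d}) = finrank (ZMod 2) T + 1 := by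
    have h1 := Submodule.finrank_sup_add_finrank_inf_eq T (Submodule.span (ZMod 2) {d})
    have h2 : T ⊓ Submodule.span (ZMod 2) {d} = ⊥ := by
      rw [← disjoint_iff]
      exact Submodule.disjoint_span_singleton_of_notMem hdT
    rw [h2, finrank_bot, finrank_span_singleton (hC d hd).1] at h1
    omega
  obtain ⟨W₀, hW₀, hle⟩ := hWQ.exists_isGenerator
  have hTg : finrank (ZMod 2) T ≤ g := by
    have := Submodule.finrank_mono hle
    rw [hrank, hW₀.finrank_eq hg] at this
    omega
  have hcover : insert 0 C ⊆ ((T ⊓ α : Submodule (ZMod 2) V) : Set V) ∪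
      ((· + c) '' ((T ⊓ perp Q α : Submodule (ZMod 2) V) : Set V) ∪
        ((· + d) '' (T : Set V)) \ (perp Q α : Set V)) := by
    have hcc : ∀ v w : V, v + w + w = v := fun v w => by
      rw [add_assoc, ZModModule.add_self, add_zero]
    rintro v (rfl | hv)
    · exact Or.inl (Submodule.zero_mem _)
    have hτv := hτT v hv
    by_cases h1 : v ∈ α
    · rw [τ1 v h1] at hτv
      exact Or.inl ⟨hτv, h1⟩
    by_cases h2 : v ∈ perp Q α
    · rw [τ2 v h1 h2] at hτv
      exact Or.inr (Or.inl ⟨v + c, ⟨hτv, Submodule.add_mem _ h2 hcp⟩, hcc v c⟩)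
    · rw [τ3 v h2] at hτv
      exact Or.inr (Or.inr ⟨⟨v + d, hτv, hcc v d⟩, h2⟩)
  have hcount : 2 ^ (g + 1) ≤ ((T ⊓ α : Submodule (ZMod 2) V) : Set V).ncard +
      (((T ⊓ perp Q α : Submodule (ZMod 2) V) : Set V).ncard +
        (((· + d) '' (T : Set V)) \ (perp Q α : Set V)).ncard) := by
    have h0 : (0 : V) ∉ C := fun h => (hC 0 h).1 rfl
    refine hcard.trans ?_
    rw [← Set.ncard_insert_of_notMem h0 (Set.toFinite C)]
    refine (Set.ncard_le_ncard hcover (Set.toFinite _)).trans ((Set.ncard_union_le _ _).trans ?_)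
    refine Nat.add_le_add_left ((Set.ncard_union_le _ _).trans ?_) _
    exact Nat.add_le_add_right (Set.ncard_image_le (Set.toFinite _)) _
  have hd1 : (((· + d) '' (T : Set V)) \ (perp Q α : Set V)).ncard ≤ (T : Set V).ncard :=
    (Set.ncard_le_ncard Set.sdiff_subset).trans Set.ncard_image_le
  have hα1 : ((T ⊓ α : Submodule (ZMod 2) V) : Set V).ncard ≤
      ((T ⊓ perp Q α : Submodule (ZMod 2) V) : Set V).ncard :=
    Set.ncard_le_ncard fun v hv => ⟨hv.1, hα.le_perp hv.2⟩
  have hT1 : (T : Set V).ncard ≤ 2 ^ g := by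
    rw [ncard_submodule]
    exact Nat.pow_le_pow_right two_pos hTg
  rw [pow_succ'] at hcount
  have hgen : (T : Set V).ncard = 2 ^ g → IsGenerator Q (T ⊔ Submodule.span (ZMod 2) {d}) := by
    intro h
    rw [ncard_submodule, Nat.pow_right_inj one_lt_two] at h
    refine hW₀.of_finrank_le hWQ ?_
    rw [hrank, h, hW₀.finrank_eq hg]
  have hmem : ∀ v, v ∈ T ⊔ Submodule.span (ZMod 2) {d} → v ∈ T ∨ ∃ t ∈ T, v = t + d := by
    intro v hv
    obtain ⟨t, ht, w, hw, rfl⟩ := Submodule.mem_sup.1 hv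
    obtain ⟨k, rfl⟩ := Submodule.mem_span_singleton.1 hw
    by_cases hk : k = 0
    · left; simpa [hk] using ht
    · right; exact ⟨t, ht, by rw [eq_one_of_ne_zero hk, one_smul]⟩
  by_cases hTp : T ≤ perp Q α
  · have hcardT : (T : Set V).ncard = 2 ^ g := by
      have h1 : ((T ⊓ perp Q α : Submodule (ZMod 2) V) : Set V).ncard ≤ (T : Set V).ncard :=
        Set.ncard_le_ncard fun v hv => hv.1
      -- Otherwise `T` has at most `2 ^ (g - 1)` vectors, and `3 * 2 ^ (g - 1) < 2 ^ (g + 1)`.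
      by_contra hne
      have h2 : finrank (ZMod 2) T < g := by
        refine lt_of_le_of_ne hTg fun h => hne ?_
        rw [ncard_submodule, h]
      have h3 : 2 * (T : Set V).ncard ≤ 2 ^ g := by
        rw [ncard_submodule, ← pow_succ']
        exact Nat.pow_le_pow_right two_pos h2
      have h4 : 0 < (T : Set V).ncard := by rw [ncard_submodule]; positivity
      omega
    refine ⟨_, hgen hcardT, fun v hv => ?_⟩
    have hτv := hτT v hv
    by_cases h1 : v ∈ α
    · rw [τ1 v h1] at hτv
      exact Or.inr ⟨Submodule.mem_sup_left hτv, fun _ => h1⟩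
    by_cases h2 : v ∈ perp Q α
    · refine Or.inl ⟨h2, h1, fun y hy => ?_⟩
      rcases hmem y hy with ht | ⟨t, ht, rfl⟩
      · exact ⟨fun _ => hTp ht, fun _ => polar_eq_zero_of_mem_perp ht (hTC v hv)⟩
      · rw [polar_add_right, polar_eq_zero_of_mem_perp ht (hTC v hv), zero_add,
          hmix v hv h2 h1 d hd hdp]
        exact ⟨fun h => absurd h one_ne_zero, fun h => absurd
          (by simpa using Submodule.sub_mem _ h (hTp ht)) hdp⟩
    · rw [τ3 v h2] at hτv
      refine Or.inr ⟨?_, fun h => absurd h h2⟩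
      have := Submodule.sub_mem (T ⊔ Submodule.span (ZMod 2) {d}) (Submodule.mem_sup_left hτv)
        (Submodule.mem_sup_right (Submodule.mem_span_singleton_self d))
      simpa using this
  · -- Here equality holds in all estimates, which yields a generator whose vectors orthogonal to
    -- `α` all lie in `α`.
    exfalso
    have h1 : 2 * ((T ⊓ perp Q α : Submodule (ZMod 2) V) : Set V).ncard ≤ (T : Set V).ncard :=
      two_mul_ncard_le (inf_lt_left.2 hTp)
    obtain ⟨w, hw, hwα, hwp⟩ := (hgen (by omega)).exists_mem_perp hαg hα
    rcases hmem w hw with ht | ⟨t, ht, rfl⟩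
    · have h2 : ((T ⊓ α : Submodule (ZMod 2) V) : Set V) =
          ((T ⊓ perp Q α : Submodule (ZMod 2) V) : Set V) :=
        Set.eq_of_subset_of_ncard_le (fun v hv => ⟨hv.1, hα.le_perp hv.2⟩) (by omega)
      have h3 : w ∈ ((T ⊓ perp Q α : Submodule (ZMod 2) V) : Set V) := ⟨ht, hwp⟩
      rw [← h2] at h3
      exact hwα h3.2
    · have h2 : (((· + d) '' (T : Set V)) \ (perp Q α : Set V)).ncard <
          ((· + d) '' (T : Set V)).ncard :=
        Set.ncard_lt_ncard ⟨Set.sdiff_subset, fun h => (h ⟨t, ht, rfl⟩).2 hwp⟩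
      have h3 := h2.trans_le Set.ncard_image_le
      omega

/-- Every clique of the switched graph with at least as many points as a generator is contained
in one of the cliques that replace the generators. -/
theorem exists_subset_switchedSpace (hα : ContainedIn Q α) (hαg : ¬ IsGenerator Q α)
    {g : ℕ} (hg : HasProjectiveIndex Q g) {C : Set V} (hC : ∀ v ∈ C, v ≠ 0 ∧ Q v = 0)
    (hadj : ∀ u ∈ C, ∀ v ∈ C, NewOrth Q α u v) (hcard : 2 ^ (g + 1) ≤ C.ncard + 1) :
    ∃ W, IsGenerator Q W ∧ C ⊆ switchedSpace Q α W := by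
  by_cases h2 : ∃ c ∈ C, c ∈ perp Q α ∧ c ∉ α
  · obtain ⟨c, hc, hcp, hcα⟩ := h2
    by_cases h3 : ∃ d ∈ C, d ∉ perp Q α
    · obtain ⟨d, hd, hdp⟩ := h3
      exact exists_subset_switchedSpace_of_mixed hα hαg hg hC hadj hcard hc hcp hcα hd hdp
    · push Not at h3
      have hS : ContainedIn Q (Submodule.span (ZMod 2) C) := by
        refine containedIn_span (fun v hv => (hC v hv).2) fun u hu v hv => ?_
        refine (hadj u hu v hv).polar_eq_zero ?_
        have := h3 u hu
        have := h3 v hv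
        unfold Switched; tauto
      obtain ⟨W, hW, hle⟩ := (hα.sup hS (Submodule.span_le.2 h3)).exists_isGenerator
      refine ⟨W, hW, fun v hv => ?_⟩
      exact (hW.switchedSpace_eq (hW.1.le_perp.trans (perp_anti (le_sup_left.trans hle)))
        (hC v hv).2).2 (hle (Submodule.mem_sup_right (Submodule.subset_span hv)))
  · push Not at h2
    have hS : ContainedIn Q (Submodule.span (ZMod 2) C) := by
      refine containedIn_span (fun v hv => (hC v hv).2) fun u hu v hv => ?_
      refine (hadj u hu v hv).polar_eq_zero ?_
      have := h2 u hu
      have := h2 v hv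
      unfold Switched; tauto
    obtain ⟨W, hW, hle⟩ := hS.exists_isGenerator
    exact ⟨W, hW, fun v hv => Or.inr ⟨hle (Submodule.subset_span hv), h2 v hv⟩⟩

end Counting

end Quadric

/-! ### Maximal cliques and graph isomorphisms -/

theorem SimpleGraph.Iso.maximal_isClique_image {P P' : Type*} {G : SimpleGraph P}
    {H : SimpleGraph P'} (e : G ≃g H) {C : Set P} (hC : Maximal G.IsClique C) :
    Maximal H.IsClique (e '' C) := by
  constructor
  · rintro _ ⟨x, hx, rfl⟩ _ ⟨y, hy, rfl⟩ hne
    exact e.map_adj_iff.2 (hC.1 hx hy fun h => hne (h ▸ rfl))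
  · intro D hD hle y hy
    have h1 : G.IsClique (e ⁻¹' D) := fun x hx z hz hne =>
      e.map_adj_iff.1 (hD hx hz fun h => hne (e.injective h))
    have h2 := hC.2 h1 fun x hx => hle ⟨x, hx, rfl⟩
    exact ⟨e.symm y, h2 (by simpa using hy), by simp⟩

theorem SimpleGraph.Iso.ncard_maximal_isClique_le {P P' : Type*} [Finite P'] {G : SimpleGraph P}
    {H : SimpleGraph P'} (e : G ≃g H) :
    {C : Set P | Maximal G.IsClique C}.ncard ≤ {C : Set P' | Maximal H.IsClique C}.ncard :=
  Set.ncard_le_ncard_of_injOn (fun C => e '' C) (fun _ hC => e.maximal_isClique_image hC)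
    (Set.image_injective.2 e.injective).injOn (Set.toFinite _)

/-! ### Points of the quadric and counts of cliques -/

namespace Quadric

open Module QuadraticMap

section Points

variable {V : Type*} [AddCommGroup V] [Module (ZMod 2) V]
  {Q : QuadraticForm (ZMod 2) V} {α : Submodule (ZMod 2) V}

/-- The nonzero vector that represents the point `X`; it is unique over the field of two
elements. -/
noncomputable def vec (X : Point Q) : V := X.1.rep

theorem vec_ne_zero (X : Point Q) : vec X ≠ 0 := X.1.rep_nonzero

theorem space_le_iff {X : Point Q} {W : Submodule (ZMod 2) V} : X.space ≤ W ↔ vec X ∈ W := by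
  rw [Point.space, Projectivization.submodule_eq, Submodule.span_singleton_le_iff_mem]; rfl

theorem map_vec (X : Point Q) : Q (vec X) = 0 := X.2 _ (space_le_iff.1 le_rfl)

/-- The point of the quadric represented by a nonzero singular vector. -/
noncomputable def ofVec (v : V) (h : v ≠ 0 ∧ Q v = 0) : Point Q :=
  ⟨Projectivization.mk (ZMod 2) v h.1, by
    rw [Projectivization.submodule_mk]; exact containedIn_span_singleton h.2⟩

@[simp]
theorem vec_ofVec (v : V) (h : v ≠ 0 ∧ Q v = 0) : vec (ofVec v h) = v := by
  obtain ⟨a, ha⟩ := Projectivization.exists_smul_eq_mk_rep (ZMod 2) v h.1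
  rw [Subsingleton.elim a 1, one_smul] at ha
  exact ha.symm

theorem vec_injective : Function.Injective (vec (Q := Q)) := by
  intro X Y h
  apply Subtype.ext
  rw [← X.1.mk_rep, ← Y.1.mk_rep]
  congr 1

theorem pointGraph_adj {X Y : Point Q} :
    (pointGraph Q).Adj X Y ↔ X ≠ Y ∧ polar Q (vec X) (vec Y) = 0 := by
  constructor
  · rintro ⟨hne, L, -, hL, hX, hY⟩
    exact ⟨hne, hL.polar_eq_zero (space_le_iff.1 hX) (space_le_iff.1 hY)⟩
  · rintro ⟨hne, h⟩
    refine ⟨hne, Submodule.span (ZMod 2) {vec X} ⊔ Submodule.span (ZMod 2) {vec Y}, ?_, ?_,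
      space_le_iff.2 (Submodule.mem_sup_left (Submodule.mem_span_singleton_self _)),
      space_le_iff.2 (Submodule.mem_sup_right (Submodule.mem_span_singleton_self _))⟩
    · have h1 := Submodule.finrank_sup_add_finrank_inf_eq (Submodule.span (ZMod 2) {vec X})
        (Submodule.span (ZMod 2) {vec Y})
      have h2 : Submodule.span (ZMod 2) {vec X} ⊓ Submodule.span (ZMod 2) {vec Y} = ⊥ := by
        rw [← disjoint_iff]
        refine Submodule.disjoint_span_singleton_of_notMem fun hmem => ?_
        obtain ⟨k, hk⟩ := Submodule.mem_span_singleton.1 hmem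
        by_cases hk0 : k = 0
        · rw [hk0, zero_smul] at hk
          exact vec_ne_zero Y hk.symm
        · rw [eq_one_of_ne_zero hk0, one_smul] at hk
          exact hne (vec_injective hk)
      rw [h2, finrank_bot, finrank_span_singleton (vec_ne_zero X),
        finrank_span_singleton (vec_ne_zero Y)] at h1
      exact h1
    · refine (containedIn_span_singleton (map_vec X)).sup (containedIn_span_singleton (map_vec Y))
        (span_singleton_le_perp fun u hu => ?_)
      obtain ⟨k, rfl⟩ := Submodule.mem_span_singleton.1 hu
      rw [polar_smul_left, h, smul_zero]

theorem pointGraph_isClique {C : Set (Point Q)} :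
    (pointGraph Q).IsClique C ↔ ∀ X ∈ C, ∀ Y ∈ C, polar Q (vec X) (vec Y) = 0 := by
  constructor
  · intro h X hX Y hY
    by_cases hXY : X = Y
    · rw [hXY, polar_self, map_vec, smul_zero]
    · exact (pointGraph_adj.1 (h hX hY hXY)).2
  · exact fun h X hX Y hY hne => pointGraph_adj.2 ⟨hne, h X hX Y hY⟩

/-- The translate of the point `X` by the vector `a`, where this is a point of the quadric, and
`X` itself otherwise. -/
noncomputable def translate (a : V) (X : Point Q) : Point Q :=
  open Classical in if h : vec X + a ≠ 0 ∧ Q (vec X + a) = 0 then ofVec _ h else X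

theorem vec_translate (hα : ContainedIn Q α) {a : V} (ha : a ∈ α) {X : Point Q}
    (hX : vec X ∈ perp Q α ∧ vec X ∉ α) : vec (translate a X) = vec X + a := by
  have h : vec X + a ≠ 0 ∧ Q (vec X + a) = 0 := by
    refine ⟨fun h => hX.2 ?_, ?_⟩
    · rw [eq_neg_of_add_eq_zero_left h]; exact α.neg_mem ha
    · rw [QuadraticMap.map_add Q, map_vec, hα a ha, polar_eq_zero_of_mem_perp ha hX.1]; simp
  rw [translate, dif_pos h, vec_ofVec]

theorem translate_mem (hα : ContainedIn Q α) {a : V} (ha : a ∈ α) {X : Point Q}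
    (hX : vec X ∈ perp Q α ∧ vec X ∉ α) :
    vec (translate a X) ∈ perp Q α ∧ vec (translate a X) ∉ α := by
  rw [vec_translate hα ha hX]
  exact ⟨Submodule.add_mem _ hX.1 (hα.le_perp ha), fun h => hX.2 ((α.add_mem_iff_left ha).1 h)⟩

theorem translate_translate (hα : ContainedIn Q α) {a : V} (ha : a ∈ α) {X : Point Q}
    (hX : vec X ∈ perp Q α ∧ vec X ∉ α) : translate a (translate a X) = X := by
  apply vec_injective
  rw [vec_translate hα ha (translate_mem hα ha hX), vec_translate hα ha hX, add_assoc,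
    ZModModule.add_self, add_zero]

/-- The points of the subspace `W`. -/
def points (Q : QuadraticForm (ZMod 2) V) (W : Submodule (ZMod 2) V) : Set (Point Q) :=
  {X | vec X ∈ W}

/-- The clique of the switched graph that replaces the points of the generator `W`. -/
def switchedPoints (Q : QuadraticForm (ZMod 2) V) (α W : Submodule (ZMod 2) V) :
    Set (Point Q) :=
  {X | vec X ∈ switchedSpace Q α W}

theorem ContainedIn.isClique_points {W : Submodule (ZMod 2) V} (hW : ContainedIn Q W) :
    (pointGraph Q).IsClique (points Q W) :=
  pointGraph_isClique.2 fun _ hX _ hY => hW.polar_eq_zero hX hY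

theorem ContainedIn.le_of_points_subset {U W : Submodule (ZMod 2) V} (hU : ContainedIn Q U)
    (h : points Q U ⊆ points Q W) : U ≤ W := by
  intro v hv
  by_cases h0 : v = 0
  · rw [h0]; exact W.zero_mem
  have hv' : v ≠ 0 ∧ Q v = 0 := ⟨h0, hU v hv⟩
  have := h (show ofVec v hv' ∈ points Q U by simpa [points] using hv)
  simpa [points] using this

theorem ncard_image_switchedPoints (hα : ContainedIn Q α) :
    (switchedPoints Q α '' {W | IsGenerator Q W}).ncard = {W | IsGenerator Q W}.ncard := by
  have key : ∀ U W, IsGenerator Q U → IsGenerator Q W →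
      switchedPoints Q α U = switchedPoints Q α W → U ≤ W := fun U W hU hW h =>
    hU.le_of_switchedSpace_subset hW hα fun v hv hv0 hvQ => by
      have := h.subset (show ofVec v ⟨hv0, hvQ⟩ ∈ switchedPoints Q α U by
        simpa [switchedPoints] using hv)
      simpa [switchedPoints] using this
  exact Set.InjOn.ncard_image fun U hU W hW h =>
    le_antisymm (key U W hU hW h) (key W U hW hU h.symm)

variable [Finite V]

theorem mem_typeTwo (hα : ContainedIn Q α) {s : ℕ} (hs : IsSpace s α) {X : Point Q} :
    X ∈ typeTwo Q s α ↔ vec X ∈ perp Q α ∧ vec X ∉ α := by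
  constructor
  · rintro ⟨h, W, -, hαW, hW, hX⟩
    exact ⟨perp_anti hαW (hW.le_perp (space_le_iff.1 hX)), fun h' => h (space_le_iff.2 h')⟩
  · rintro ⟨h1, h2⟩
    refine ⟨fun h' => h2 (space_le_iff.1 h'), α ⊔ Submodule.span (ZMod 2) {vec X}, ?_, le_sup_left,
      hα.sup (containedIn_span_singleton (map_vec X)) (span_singleton_le_perp h1),
      space_le_iff.2 (Submodule.mem_sup_right (Submodule.mem_span_singleton_self _))⟩
    have h3 := Submodule.finrank_sup_add_finrank_inf_eq α (Submodule.span (ZMod 2) {vec X})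
    rw [disjoint_iff.1 (Submodule.disjoint_span_singleton_of_notMem h2), finrank_bot,
      finrank_span_singleton (vec_ne_zero X), show finrank (ZMod 2) α = s + 1 from hs] at h3
    exact h3

theorem typeTwo_nonempty (hα : ContainedIn Q α) (hαg : ¬ IsGenerator Q α) {s : ℕ}
    (hs : IsSpace s α) : (typeTwo Q s α).Nonempty := by
  obtain ⟨W, hW, -⟩ := hα.exists_isGenerator
  obtain ⟨x, hx, hxα, hxp⟩ := hW.exists_mem_perp hαg hα
  exact ⟨ofVec x ⟨fun h => hxα (h ▸ α.zero_mem), hW.1 x hx⟩,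
    (mem_typeTwo hα hs).2 (by rw [vec_ofVec]; exact ⟨hxp, hxα⟩)⟩

/-- The vertices whose neighbourhoods change are the points of type (iii): translation by a vector
of `α` that is not orthogonal to `R` exchanges the neighbours and the non-neighbours of `R` among
the points of type (ii), while a point of `α` is adjacent to all of them. -/
theorem isHalf_iff (hα : ContainedIn Q α) (hαg : ¬ IsGenerator Q α) {s : ℕ}
    (hs : IsSpace s α) {R : Point Q} :
    GodsilMcKay.IsHalf (pointGraph Q) (typeTwo Q s α) R ↔ vec R ∉ perp Q α := by
  constructor
  · rintro ⟨hR, hcard⟩ hRp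
    have hRα : vec R ∈ α := by
      by_contra h
      exact hR ((mem_typeTwo hα hs).2 ⟨hRp, h⟩)
    have hall : (pointGraph Q).neighborSet R ∩ typeTwo Q s α = typeTwo Q s α := by
      refine Set.inter_eq_right.2 fun X hX => ?_
      rw [SimpleGraph.mem_neighborSet, pointGraph_adj]
      exact ⟨fun h => hR (h ▸ hX), ((mem_typeTwo hα hs).1 hX).1 _ hRα⟩
    rw [hall] at hcard
    have := (Set.ncard_pos (Set.toFinite _)).2 (typeTwo_nonempty hα hαg hs)
    omega
  · intro hRp
    have hR : R ∉ typeTwo Q s α := fun h => hRp ((mem_typeTwo hα hs).1 h).1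
    refine ⟨hR, ?_⟩
    obtain ⟨a, ha, haR⟩ : ∃ a ∈ α, polar Q a (vec R) ≠ 0 := by
      by_contra! h
      exact hRp h
    have hadj : ∀ X ∈ typeTwo Q s α,
        (X ∈ (pointGraph Q).neighborSet R ↔ polar Q (vec R) (vec X) = 0) := fun X hX => by
      rw [SimpleGraph.mem_neighborSet, pointGraph_adj]
      exact and_iff_right fun h => hR (h ▸ hX)
    have hflip : ∀ X ∈ typeTwo Q s α, translate a X ∈ typeTwo Q s α ∧
        (translate a X ∈ (pointGraph Q).neighborSet R ↔
          X ∉ (pointGraph Q).neighborSet R) := by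
      intro X hX
      have hX' := (mem_typeTwo hα hs).1 hX
      have h1 := (mem_typeTwo hα hs).2 (translate_mem hα ha hX')
      refine ⟨h1, ?_⟩
      rw [hadj X hX, hadj _ h1, vec_translate hα ha hX', polar_add_right, polar_comm Q _ a,
        eq_one_of_ne_zero haR]
      generalize polar Q (vec R) (vec X) = t
      revert t
      decide
    have hinj : Set.InjOn (translate a) (typeTwo Q s α) := fun X hX Y hY h => by
      rw [← translate_translate hα ha ((mem_typeTwo hα hs).1 hX), h,
        translate_translate hα ha ((mem_typeTwo hα hs).1 hY)]
    have h1 : ((pointGraph Q).neighborSet R ∩ typeTwo Q s α).ncard ≤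
        (typeTwo Q s α \ (pointGraph Q).neighborSet R).ncard :=
      Set.ncard_le_ncard_of_injOn (translate a)
        (fun X hX => ⟨(hflip X hX.2).1, fun h => (hflip X hX.2).2.1 h hX.1⟩)
        (hinj.mono Set.inter_subset_right)
    have h2 : (typeTwo Q s α \ (pointGraph Q).neighborSet R).ncard ≤
        ((pointGraph Q).neighborSet R ∩ typeTwo Q s α).ncard :=
      Set.ncard_le_ncard_of_injOn (translate a)
        (fun X hX => ⟨(hflip X hX.1).2.2 hX.2, (hflip X hX.1).1⟩)
        (hinj.mono Set.sdiff_subset)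
    have h3 := Set.ncard_inter_add_ncard_sdiff_eq_ncard (typeTwo Q s α)
      ((pointGraph Q).neighborSet R) (Set.toFinite _)
    rw [Set.inter_comm] at h3
    omega

theorem newGraph_adj (hα : ContainedIn Q α) (hαg : ¬ IsGenerator Q α) {s : ℕ}
    (hs : IsSpace s α) {X Y : Point Q} :
    (newGraph Q s α).Adj X Y ↔ X ≠ Y ∧ NewOrth Q α (vec X) (vec Y) := by
  have h1 : GodsilMcKay.IsSwitched (pointGraph Q) (typeTwo Q s α) X Y ↔
      Switched Q α (vec X) (vec Y) := by
    unfold GodsilMcKay.IsSwitched Switched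
    rw [isHalf_iff hα hαg hs, isHalf_iff hα hαg hs, mem_typeTwo hα hs, mem_typeTwo hα hs,
      and_assoc, and_assoc]
  have h2 : Switched Q α (vec X) (vec Y) → X ≠ Y := by
    rintro h rfl
    unfold Switched at h
    tauto
  change (_ ∧ _) ∨ (_ ∧ _) ↔ _
  rw [h1, pointGraph_adj]
  unfold NewOrth
  tauto

theorem newGraph_isClique (hα : ContainedIn Q α) (hαg : ¬ IsGenerator Q α) {s : ℕ}
    (hs : IsSpace s α) {C : Set (Point Q)} :
    (newGraph Q s α).IsClique C ↔ ∀ X ∈ C, ∀ Y ∈ C, NewOrth Q α (vec X) (vec Y) := by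
  constructor
  · intro h X hX Y hY
    by_cases hXY : X = Y
    · have : polar Q (vec Y) (vec Y) = 0 := by rw [polar_self, map_vec, smul_zero]
      subst hXY
      unfold NewOrth Switched
      tauto
    · exact ((newGraph_adj hα hαg hs).1 (h hX hY hXY)).2
  · exact fun h X hX Y hY hne => (newGraph_adj hα hαg hs).2 ⟨hne, h X hX Y hY⟩

theorem ncard_points {g : ℕ} (hg : HasProjectiveIndex Q g) {W : Submodule (ZMod 2) V}
    (hW : IsGenerator Q W) : (points Q W).ncard + 1 = 2 ^ (g + 1) := by
  have h1 : vec '' points Q W = (W : Set V) \ {0} := by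
    ext v
    constructor
    · rintro ⟨X, hX, rfl⟩; exact ⟨hX, vec_ne_zero X⟩
    · rintro ⟨hv, h0⟩
      have hv' : v ≠ 0 ∧ Q v = 0 := ⟨h0, hW.1 v hv⟩
      exact ⟨ofVec v hv', by simpa [points] using hv, vec_ofVec v hv'⟩
  rw [← Set.ncard_image_of_injective _ vec_injective, h1,
    Set.ncard_sdiff_singleton_add_one (show (0 : V) ∈ (W : Set V) from W.zero_mem),
    ncard_submodule, hW.finrank_eq hg]

theorem exists_subset_points {C : Set (Point Q)} (hC : (pointGraph Q).IsClique C) :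
    ∃ W, IsGenerator Q W ∧ C ⊆ points Q W := by
  have hS : ContainedIn Q (Submodule.span (ZMod 2) (vec '' C)) := by
    refine containedIn_span ?_ ?_
    · rintro _ ⟨X, -, rfl⟩; exact map_vec X
    · rintro _ ⟨X, hX, rfl⟩ _ ⟨Y, hY, rfl⟩; exact pointGraph_isClique.1 hC X hX Y hY
  obtain ⟨W, hW, hle⟩ := hS.exists_isGenerator
  exact ⟨W, hW, fun X hX => hle (Submodule.subset_span (Set.mem_image_of_mem vec hX))⟩

/-- The maximal cliques of the point-graph are the generators. -/
theorem setOf_maximal_isClique_pointGraph :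
    {C : Set (Point Q) | Maximal (pointGraph Q).IsClique C} =
      points Q '' {W | IsGenerator Q W} := by
  ext C
  constructor
  · intro hC
    obtain ⟨W, hW, hle⟩ := exists_subset_points hC.1
    exact ⟨W, hW, (hC.eq_of_le hW.1.isClique_points hle).symm⟩
  · rintro ⟨W, hW, rfl⟩
    refine ⟨hW.1.isClique_points, fun D hD hle => ?_⟩
    obtain ⟨U, hU, hDU⟩ := exists_subset_points hD
    have := hW.eq_of_le hU.1 (hW.1.le_of_points_subset (hle.trans hDU))
    rw [this]
    exact hDU

theorem ncard_maximal_isClique_pointGraph :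
    {C : Set (Point Q) | Maximal (pointGraph Q).IsClique C}.ncard =
      {W | IsGenerator Q W}.ncard := by
  rw [setOf_maximal_isClique_pointGraph]
  exact Set.InjOn.ncard_image fun U hU W hW h =>
    le_antisymm (hU.1.le_of_points_subset h.subset) (hW.1.le_of_points_subset h.superset)

/-- All generators have the same number of points, so that all maximal cliques of the point-graph
have maximum size. -/
theorem ncard_isMaximumClique_pointGraph {g : ℕ} (hg : HasProjectiveIndex Q g) :
    {C : Finset (Point Q) | (pointGraph Q).IsMaximumClique C}.ncard =
      {W | IsGenerator Q W}.ncard := by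
  rw [← ncard_maximal_isClique_pointGraph, ← Set.ncard_image_of_injective _ Finset.coe_injective]
  congr 1
  ext C
  constructor
  · rintro ⟨C, hC, rfl⟩; exact hC.isMaximalClique
  · intro hC
    refine ⟨(Set.toFinite C).toFinset, ⟨by simpa using hC.1, fun t ht => ?_⟩, by simp⟩
    rw [setOf_maximal_isClique_pointGraph] at hC
    obtain ⟨W, hW, rfl⟩ := hC
    obtain ⟨U, hU, htU⟩ := exists_subset_points ht
    have h1 := Set.ncard_le_ncard htU
    have h2 := ncard_points hg hU
    have h3 := ncard_points hg hW
    rw [Set.ncard_coe_finset] at h1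
    rw [← Set.ncard_eq_toFinset_card]
    omega

theorem IsGenerator.maximal_isClique_switchedPoints (hα : ContainedIn Q α)
    (hαg : ¬ IsGenerator Q α) {s : ℕ} (hs : IsSpace s α) {W : Submodule (ZMod 2) V}
    (hW : IsGenerator Q W) : Maximal (newGraph Q s α).IsClique (switchedPoints Q α W) := by
  constructor
  · exact (newGraph_isClique hα hαg hs).2 fun X hX Y hY =>
      hW.newOrth_of_mem hα (map_vec X) (map_vec Y) hX hY
  · intro D hD hle X hX
    refine hW.mem_switchedSpace hα (map_vec X) fun u hu hu0 huQ => ?_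
    have := (newGraph_isClique hα hαg hs).1 hD (ofVec u ⟨hu0, huQ⟩)
      (hle (by simpa [switchedPoints] using hu)) X hX
    rwa [vec_ofVec] at this

/-- The switched graph has more inclusion-maximal cliques than there are generators. -/
theorem ncard_isGenerator_lt_ncard_maximal_isClique (hQ : IsNonsingular Q)
    (hα : ContainedIn Q α) (hαg : ¬ IsGenerator Q α) {s : ℕ} (hs : IsSpace s α) (h1 : 1 ≤ s) :
    {W | IsGenerator Q W}.ncard <
      {C : Set (Point Q) | Maximal (newGraph Q s α).IsClique C}.ncard := by
  rw [← ncard_image_switchedPoints hα]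
  apply Set.ncard_lt_ncard _ (Set.toFinite _)
  refine ⟨?_, fun hsub => ?_⟩
  · rintro _ ⟨W, hW, rfl⟩
    exact hW.maximal_isClique_switchedPoints hα hαg hs
  obtain ⟨S, hS, hadj, hno⟩ := exists_newOrth_not_subset_switchedSpace hQ hα hαg
    (show 1 < finrank (ZMod 2) α by rw [show finrank (ZMod 2) α = s + 1 from hs]; omega)
  have hC : (newGraph Q s α).IsClique {X : Point Q | vec X ∈ S} :=
    (newGraph_isClique hα hαg hs).2 fun X hX Y hY => hadj _ hX _ hY
  obtain ⟨D, hle, hD⟩ := (Set.toFinite {C | (newGraph Q s α).IsClique C}).exists_le_maximal hC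
  obtain ⟨W, -, rfl⟩ := hsub hD
  refine hno W fun v hv => ?_
  have := hle (show vec (ofVec v (hS v hv)) ∈ S by rwa [vec_ofVec])
  simpa [switchedPoints] using this

/-- The switched graph has fewer cliques of maximum size than there are generators: all of them
replace generators, but those replacing generators disjoint from `α` are too small. -/
theorem ncard_isMaximumClique_lt_ncard_isGenerator (hQ : IsNonsingular Q) {g : ℕ}
    (hg : HasProjectiveIndex Q g) (hα : ContainedIn Q α) (hαg : ¬ IsGenerator Q α) {s : ℕ}
    (hs : IsSpace s α) (h1 : 1 ≤ s) :
    {C : Finset (Point Q) | (newGraph Q s α).IsMaximumClique C}.ncard <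
      {W | IsGenerator Q W}.ncard := by
  -- The generators that contain `α` bound the size of a maximum clique from below.
  have hsize : ∀ C : Finset (Point Q), (newGraph Q s α).IsMaximumClique C →
      2 ^ (g + 1) ≤ (C : Set (Point Q)).ncard + 1 := by
    intro C hC
    obtain ⟨W, hW, hαW⟩ := hα.exists_isGenerator
    have h2 : points Q W ⊆ switchedPoints Q α W := fun X hX =>
      (hW.switchedSpace_eq (hW.1.le_perp.trans (perp_anti hαW)) (map_vec X)).2 hX
    have h3 := hC.maximum (Set.toFinite (points Q W)).toFinset (by
      simpa using (hW.maximal_isClique_switchedPoints hα hαg hs).1.subset h2)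
    rw [← Set.ncard_eq_toFinset_card] at h3
    rw [Set.ncard_coe_finset, ← ncard_points hg hW]
    omega
  rw [← ncard_image_switchedPoints hα, ← Set.ncard_image_of_injective _ Finset.coe_injective]
  apply Set.ncard_lt_ncard _ (Set.toFinite _)
  refine ⟨?_, fun hsub => ?_⟩
  · rintro _ ⟨C, hC, rfl⟩
    obtain ⟨W, hW, hCW⟩ := exists_subset_switchedSpace hα hαg hg
      (C := vec '' (C : Set (Point Q)))
      (by rintro _ ⟨X, -, rfl⟩; exact ⟨vec_ne_zero X, map_vec X⟩)
      (by
        rintro _ ⟨X, hX, rfl⟩ _ ⟨Y, hY, rfl⟩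
        exact (newGraph_isClique hα hαg hs).1 hC.isClique X hX Y hY)
      (by rw [Set.ncard_image_of_injective _ vec_injective]; exact hsize C hC)
    exact ⟨W, hW, (hC.isMaximalClique.eq_of_le (hW.maximal_isClique_switchedPoints hα hαg hs).1
      fun X hX => hCW (Set.mem_image_of_mem vec hX)).symm⟩
  · obtain ⟨W, hW, hWα⟩ := IsGenerator.exists_inf_eq_bot hQ hα
    obtain ⟨x, hx, hxα, hxp⟩ := hW.exists_mem_perp hαg hα
    obtain ⟨C, hC, hCW⟩ := hsub ⟨W, hW, rfl⟩
    have h2 := hsize C hC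
    have h3 : (C : Set (Point Q)) ⊂ points Q W := by
      have key : ∀ X ∈ switchedPoints Q α W, vec X ∈ W ∧ (vec X ∈ perp Q α → vec X ∈ α) :=
        fun X hX => hW.switchedSpace_subset_of_inf_eq_bot hα hWα
          (show 1 < finrank (ZMod 2) α by rw [show finrank (ZMod 2) α = s + 1 from hs]; omega) hX
      have hx' : x ≠ 0 ∧ Q x = 0 := ⟨fun h => hxα (h ▸ α.zero_mem), hW.1 x hx⟩
      rw [hCW]
      refine ⟨fun X hX => (key X hX).1, fun hle => ?_⟩
      have h4 := (key _ (hle (show ofVec x hx' ∈ points Q W by simpa [points] using hx))).2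
      rw [vec_ofVec] at h4
      exact hxα (h4 hxp)
    have h4 := Set.ncard_lt_ncard h3
    have h5 := ncard_points hg hW
    omega

/-- If `α` is a single point `a`, translation of the points of type (ii) by `a` undoes the
switching. -/
theorem exists_iso_newGraph (hα : ContainedIn Q α) (hαg : ¬ IsGenerator Q α)
    (hs : IsSpace 0 α) :
    ∃ φ : pointGraph Q ≃g newGraph Q 0 α,
      (∀ X, φ (φ X) = X) ∧ (∀ X ∉ typeTwo Q 0 α, φ X = X) ∧
      (∀ X ∈ typeTwo Q 0 α,
        φ X ∈ typeTwo Q 0 α ∧ φ X ≠ X ∧ (φ X).space ≤ α ⊔ X.space) := by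
  classical
  obtain ⟨⟨a, ha⟩, ha0, hspan⟩ := finrank_eq_one_iff'.1 (show finrank (ZMod 2) α = 1 from hs)
  have ha0' : a ≠ 0 := fun h => ha0 (Subtype.ext h)
  have hperp : ∀ v, v ∉ perp Q α → polar Q a v = 1 := by
    intro v hv
    refine eq_one_of_ne_zero fun h0 => hv fun u hu => ?_
    obtain ⟨k, hk⟩ := hspan ⟨u, hu⟩
    have hu' : k • a = u := congrArg Subtype.val hk
    rw [← hu', polar_smul_left, h0, smul_zero]
  let f : Point Q → Point Q := fun X => if X ∈ typeTwo Q 0 α then translate a X else X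
  have f1 : ∀ X ∈ typeTwo Q 0 α, f X = translate a X := fun X hX => if_pos hX
  have f2 : ∀ X ∉ typeTwo Q 0 α, f X = X := fun X hX => if_neg hX
  have f3 : ∀ X ∈ typeTwo Q 0 α, f X ∈ typeTwo Q 0 α ∧ vec (f X) = vec X + a := fun X hX => by
    have hX' := (mem_typeTwo hα hs).1 hX
    rw [f1 X hX]
    exact ⟨(mem_typeTwo hα hs).2 (translate_mem hα ha hX'), vec_translate hα ha hX'⟩
  have finv : Function.Involutive f := fun X => by
    by_cases hX : X ∈ typeTwo Q 0 α
    · rw [f1 _ (f3 X hX).1, f1 X hX]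
      exact translate_translate hα ha ((mem_typeTwo hα hs).1 hX)
    · rw [f2 X hX, f2 X hX]
  have mixed : ∀ X ∈ typeTwo Q 0 α, ∀ Y ∉ typeTwo Q 0 α,
      (NewOrth Q α (vec X + a) (vec Y) ↔ polar Q (vec X) (vec Y) = 0) := by
    intro X hX Y hY
    rw [mem_typeTwo hα hs] at hX hY
    have hXa : vec X + a ∈ perp Q α := Submodule.add_mem _ hX.1 (hα.le_perp ha)
    have hXa' : vec X + a ∉ α := fun h => hX.2 ((α.add_mem_iff_left ha).1 h)
    unfold NewOrth Switched
    rw [polar_add_left]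
    by_cases hYp : vec Y ∈ perp Q α
    · rw [hYp a ha, add_zero]
      tauto
    · rw [hperp _ hYp]
      have h2 : ∀ t : ZMod 2, t + 1 = 0 ↔ ¬ t = 0 := by decide
      rw [h2]
      tauto
  have hadj : ∀ X Y, NewOrth Q α (vec (f X)) (vec (f Y)) ↔ polar Q (vec X) (vec Y) = 0 := by
    intro X Y
    by_cases hX : X ∈ typeTwo Q 0 α <;> by_cases hY : Y ∈ typeTwo Q 0 α
    · have hX' := ((mem_typeTwo hα hs).1 (f3 X hX).1).1
      have hY' := ((mem_typeTwo hα hs).1 (f3 Y hY).1).1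
      have h3 : polar Q (vec (f X)) (vec (f Y)) = polar Q (vec X) (vec Y) := by
        rw [(f3 Y hY).2, polar_add_right, polar_eq_zero_of_mem_perp ha hX', add_zero,
          (f3 X hX).2, polar_add_left, ((mem_typeTwo hα hs).1 hY).1 a ha, add_zero]
      unfold NewOrth Switched
      rw [h3]
      tauto
    · rw [f2 Y hY, (f3 X hX).2]
      exact mixed X hX Y hY
    · rw [f2 X hX, (f3 Y hY).2, polar_comm, ← mixed Y hY X hX]
      exact ⟨NewOrth.symm, NewOrth.symm⟩
    · rw [f2 X hX, f2 Y hY]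
      rw [mem_typeTwo hα hs] at hX hY
      unfold NewOrth Switched
      tauto
  refine ⟨⟨finv.toPerm, fun {X Y} => ?_⟩, finv, f2, fun X hX => ⟨(f3 X hX).1, fun h => ?_, ?_⟩⟩
  · change (newGraph Q 0 α).Adj (f X) (f Y) ↔ _
    rw [newGraph_adj hα hαg hs, pointGraph_adj, hadj, finv.injective.ne_iff]
  · have h3 := (f3 X hX).2
    rw [show f X = X from h] at h3
    exact ha0' (by simpa using h3)
  · rw [space_le_iff]
    change vec (f X) ∈ _
    rw [(f3 X hX).2, add_comm]
    exact Submodule.add_mem_sup ha (space_le_iff.1 le_rfl)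

end Points

end Quadric

theorem theorem5p1 (n : ℕ) (Q : QuadraticForm (ZMod 2) (Fin (n + 1) → ZMod 2))
    (hQ : Quadric.IsNonsingular Q) (g : ℕ) (hg : Quadric.HasProjectiveIndex Q g)
    (s : ℕ) (hs : s < g) (α : Submodule (ZMod 2) (Fin (n + 1) → ZMod 2))
    (hα : Quadric.IsSpace s α) (hαQ : Quadric.ContainedIn Q α) :
    (Nonempty (Quadric.newGraph Q s α ≃g Quadric.pointGraph Q) ↔ s = 0) ∧
    (s = 0 → ∃ φ : Quadric.pointGraph Q ≃g Quadric.newGraph Q s α,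
      (∀ X, φ (φ X) = X) ∧
      (∀ X ∈ Quadric.typeOne Q α, φ X = X) ∧
      (∀ X ∈ Quadric.typeThree Q s α, φ X = X) ∧
      (∀ X ∈ Quadric.typeTwo Q s α,
        φ X ∈ Quadric.typeTwo Q s α ∧ φ X ≠ X ∧ (φ X).space ≤ α ⊔ X.space)) ∧
    (1 ≤ s →
      {C : Finset (Quadric.Point Q) | (Quadric.newGraph Q s α).IsMaximumClique C}.ncard ≠
        {C : Finset (Quadric.Point Q) | (Quadric.pointGraph Q).IsMaximumClique C}.ncard ∧
      {C : Set (Quadric.Point Q) | Maximal (Quadric.newGraph Q s α).IsClique C}.ncard ≠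
        {C : Set (Quadric.Point Q) | Maximal (Quadric.pointGraph Q).IsClique C}.ncard) := by
  have hαg : ¬ Quadric.IsGenerator Q α := fun h => by
    have h1 := h.finrank_eq hg
    rw [show Module.finrank (ZMod 2) α = s + 1 from hα] at h1
    omega
  have hmax := fun h1 : 1 ≤ s =>
    Quadric.ncard_isGenerator_lt_ncard_maximal_isClique hQ hαQ hαg hα h1
  rw [← Quadric.ncard_maximal_isClique_pointGraph] at hmax
  refine ⟨⟨fun ⟨e⟩ => ?_, ?_⟩, ?_, fun h1 => ⟨?_, (hmax h1).ne'⟩⟩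
  · by_contra h0
    exact (hmax (by omega)).not_ge e.ncard_maximal_isClique_le
  · rintro rfl
    obtain ⟨φ, -⟩ := Quadric.exists_iso_newGraph hαQ hαg hα
    exact ⟨φ.symm⟩
  · rintro rfl
    obtain ⟨φ, h1, h2, h3⟩ := Quadric.exists_iso_newGraph hαQ hαg hα
    exact ⟨φ, h1, fun X hX => h2 X fun h => h.1 hX, fun X hX => h2 X fun h => hX (Or.inr h), h3⟩
  · rw [Quadric.ncard_isMaximumClique_pointGraph hg]
    exact (Quadric.ncard_isMaximumClique_lt_ncard_isGenerator hQ hg hαQ hαg hα h1).ne
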